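/- Conventions. Second-order arithmetic is two-sorted classical first-order logic with equality between numbers, with variables $x,y,\dots$ for numbers and $X,Y,\dots$ for sets of numbers, over the symbols $0,\mathsf{s},+,\times,<$ and atomic formulas $t\in X$; both sorts range over arbitrary non-empty domains, and $T\vdash\varphi$ means that the closed formula $\varphi$ is a logical consequence of $T$. A formula is bounded if all its quantifiers are of the form $\forall x<t$ or $\exists x<t$, and $\Sigma^0_1$ if it has the form $\exists\vec x\,\varphi$ with $\varphi$ bounded; free number and set variables are allowed. The theory $\mathsf{RCA}_0$ consists of Robinson arithmetic with $<$, the induction axioms $\varphi(0)\wedge\forall x(\varphi(x)\supset\varphi(\mathsf{s}x))\supset\forall x\,\varphi(x)$ for $\varphi\in\Sigma^0_1$, and the recursive comprehension axioms $\forall x(\varphi(x)\equiv\neg\psi(x))\supset\exists X\,\forall x(x\in X\equiv\varphi(x))$ for $\varphi,\psi\in\Sigma^0_1$ in which $X$ is not free (universal closures are taken in both schemes). Let $(S,\bullet)$ be a finite semigroup. Inside arithmetic, its elements are represented, via an arbitrary fixed numbering, by the numerals below $|S|$, and its multiplication by its finite table. Write $\binom{\mathbb N}{2}$ for the set of pairs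 $(i,j)$ of numbers with $i<j$. A colouring $C:\binom{\mathbb N}{2}\to S$ is given by the set of codes of the triples $((i,j),c)$ with $C(i,j)=c$, where $\langle x,y\rangle=(x+y)^2+x$ codes pairs. It is additive if $C(i,j)\bullet C(j,k)=C(i,k)$ whenever $i<j<k$. For $a\in S$, a set $I\subseteq\mathbb N$ is an $a$-clique under $C$ if $C(i,j)=a$ for all $i,j\in I$ with $i<j$, and it is infinite if it has elements above every number. Theorem (Nonuniform Additive Ramsey Theorem). For every finite semigroup $(S,\bullet)$, $$\mathsf{RCA}_0\vdash \forall C:\tbinom{\mathbb N}{2}\to S.\ \bigl(\text{``}C\text{ is additive''}\supset \exists a\in S.\ \exists I\subseteq\mathbb N.\ \text{``}I\text{ is an infinite }a\text{-clique''}\bigr).$$ -/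

import Mathlib

/-! Second-order arithmetic as a two-sorted first-order logic, the theory `RCA₀`, and the
sentence expressing the additive Ramsey theorem for a fixed finite semigroup.

Variables are well-scoped de Bruijn indices: a formula in `Formula k n` has its free set variables
in `Fin k` and its free number variables in `Fin n`; a quantifier binds index `0` and shifts the
other indices of its sort by one. -/

universe u v w

namespace SOArith

/-- Number terms over `0, S, +, ×` with `n` free number variables. -/
inductive Term : ℕ → Type
  | var {n : ℕ} (i : Fin n) : Term n
  | zero {n : ℕ} : Term n
  | succ {n : ℕ} (t : Term n) : Term n
  | add {n : ℕ} (s t : Term n) : Term n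
  | mul {n : ℕ} (s t : Term n) : Term n

/-- Formulas of the language of second-order arithmetic. Equality is only between numbers, as is
usual (equality of sets is coextensionality). -/
inductive Formula : ℕ → ℕ → Type
  | eq {k n : ℕ} (s t : Term n) : Formula k n
  | lt {k n : ℕ} (s t : Term n) : Formula k n
  | mem {k n : ℕ} (t : Term n) (X : Fin k) : Formula k n
  | neg {k n : ℕ} (φ : Formula k n) : Formula k n
  | and {k n : ℕ} (φ ψ : Formula k n) : Formula k n
  | or {k n : ℕ} (φ ψ : Formula k n) : Formula k n
  | all {k n : ℕ} (φ : Formula k (n + 1)) : Formula k n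
  | ex {k n : ℕ} (φ : Formula k (n + 1)) : Formula k n
  | allSet {k n : ℕ} (φ : Formula (k + 1) n) : Formula k n
  | exSet {k n : ℕ} (φ : Formula (k + 1) n) : Formula k n

/-- Closed formulas. -/
abbrev Sentence : Type := Formula 0 0

/-- A theory is a set of closed formulas. -/
abbrev Theory : Type := Set Sentence

/-! ### Substitution -/

namespace Term

/-- Simultaneous substitution of terms for number variables. -/
def subst {n m : ℕ} (σ : Fin n → Term m) : Term n → Term m
  | var i => σ i
  | zero => zero
  | succ t => succ (t.subst σ)
  | add s t => add (s.subst σ) (t.subst σ)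
  | mul s t => mul (s.subst σ) (t.subst σ)

/-- Weakening by a new number variable with index `0`. -/
def lift {n : ℕ} (t : Term n) : Term (n + 1) := t.subst (fun i => var i.succ)

/-- The numeral `S (S (⋯ 0))`. -/
def numeral {n : ℕ} : ℕ → Term n
  | 0 => zero
  | m + 1 => succ (numeral m)

/-- The pairing `⟨s, t⟩ = (s + t)² + s`. -/
def pair {n : ℕ} (s t : Term n) : Term n := add (mul (add s t) (add s t)) s

end Term

namespace Formula

/-- Simultaneous capture-avoiding substitution of terms for number variables and renaming of set
variables. -/
def subst : {k l n m : ℕ} → (Fin k → Fin l) → (Fin n → Term m) → Formula k n → Formula l m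
  | _, _, _, _, _, σ, eq s t => eq (s.subst σ) (t.subst σ)
  | _, _, _, _, _, σ, lt s t => lt (s.subst σ) (t.subst σ)
  | _, _, _, _, τ, σ, mem t X => mem (t.subst σ) (τ X)
  | _, _, _, _, τ, σ, neg φ => neg (φ.subst τ σ)
  | _, _, _, _, τ, σ, and φ ψ => and (φ.subst τ σ) (ψ.subst τ σ)
  | _, _, _, _, τ, σ, or φ ψ => or (φ.subst τ σ) (ψ.subst τ σ)
  | _, _, _, _, τ, σ, all φ => all (φ.subst τ (Fin.cons (.var 0) fun i => (σ i).lift))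
  | _, _, _, _, τ, σ, ex φ => ex (φ.subst τ (Fin.cons (.var 0) fun i => (σ i).lift))
  | _, _, _, _, τ, σ, allSet φ => allSet (φ.subst (Fin.cons 0 fun X => (τ X).succ) σ)
  | _, _, _, _, τ, σ, exSet φ => exSet (φ.subst (Fin.cons 0 fun X => (τ X).succ) σ)

/-! ### Defined connectives -/

variable {k n : ℕ}

/-- Implication. -/
def imp (φ ψ : Formula k n) : Formula k n := or (neg φ) ψ

/-- Equivalence. -/
def iff (φ ψ : Formula k n) : Formula k n := and (imp φ ψ) (imp ψ φ)

/-- Finite disjunction (the empty one is a contradiction). -/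
def disj : List (Formula k n) → Formula k n
  | [] => neg (eq .zero .zero)
  | φ :: L => or φ (disj L)

/-- `∀ x < t. φ`, where `x` (index `0` in `φ`) does not occur in `t`. -/
def allLT (t : Term n) (φ : Formula k (n + 1)) : Formula k n :=
  all (imp (lt (.var 0) t.lift) φ)

/-- `∃ x < t. φ`, where `x` (index `0` in `φ`) does not occur in `t`. -/
def exLT (t : Term n) (φ : Formula k (n + 1)) : Formula k n :=
  ex (and (lt (.var 0) t.lift) φ)

/-- Universal closure over all free number variables. -/
def closeNum : {n : ℕ} → Formula k n → Formula k 0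
  | 0, φ => φ
  | _ + 1, φ => closeNum (all φ)

/-- Universal closure over all free set variables. -/
def closeSet : {k : ℕ} → Formula k 0 → Sentence
  | 0, φ => φ
  | _ + 1, φ => closeSet (allSet φ)

/-- Universal closure. -/
def closure (φ : Formula k n) : Sentence := closeSet (closeNum φ)

/-- Bounded (`Δ⁰₀`) formulas: all quantifiers are bounded number quantifiers; free set variables
are allowed. -/
inductive IsBounded : {k n : ℕ} → Formula k n → Prop
  | eq {k n : ℕ} (s t : Term n) : IsBounded (Formula.eq (k := k) s t)
  | lt {k n : ℕ} (s t : Term n) : IsBounded (Formula.lt (k := k) s t)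
  | mem {k n : ℕ} (t : Term n) (X : Fin k) : IsBounded (Formula.mem t X)
  | neg {k n : ℕ} {φ : Formula k n} : IsBounded φ → IsBounded (Formula.neg φ)
  | and {k n : ℕ} {φ ψ : Formula k n} :
      IsBounded φ → IsBounded ψ → IsBounded (Formula.and φ ψ)
  | or {k n : ℕ} {φ ψ : Formula k n} :
      IsBounded φ → IsBounded ψ → IsBounded (Formula.or φ ψ)
  | allLT {k n : ℕ} (t : Term n) {φ : Formula k (n + 1)} :
      IsBounded φ → IsBounded (Formula.allLT t φ)
  | exLT {k n : ℕ} (t : Term n) {φ : Formula k (n + 1)} :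
      IsBounded φ → IsBounded (Formula.exLT t φ)

/-- `Σ⁰₁` formulas: a block of existential number quantifiers in front of a bounded formula. -/
inductive IsSigma1 : {k n : ℕ} → Formula k n → Prop
  | bounded {k n : ℕ} {φ : Formula k n} : IsBounded φ → IsSigma1 φ
  | ex {k n : ℕ} {φ : Formula k (n + 1)} : IsSigma1 φ → IsSigma1 (Formula.ex φ)

/-- `φ(0)`, for the variable `x` with index `0`. -/
def substZero (φ : Formula k (n + 1)) : Formula k n :=
  φ.subst id (Fin.cons .zero .var)

/-- `φ(S x)`, for the variable `x` with index `0`. -/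
def substSucc (φ : Formula k (n + 1)) : Formula k (n + 1) :=
  φ.subst id (Fin.cons (.succ (.var 0)) fun i => .var i.succ)

/-- Weakening by a new set variable with index `0`. -/
def liftSet (φ : Formula k n) : Formula (k + 1) n := φ.subst Fin.succ .var

/-- The induction axiom `φ(0) ∧ ∀ x (φ(x) ⊃ φ(S x)) ⊃ ∀ x φ(x)`, with parameters. -/
def induction (φ : Formula k (n + 1)) : Sentence :=
  closure (imp (and φ.substZero (all (imp φ φ.substSucc))) (all φ))

/-- The comprehension axiom
`∀ x (φ(x) ≡ ¬ ψ(x)) ⊃ ∃ X ∀ x (x ∈ X ≡ φ(x))`, with parameters. -/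
def comprehension (φ ψ : Formula k (n + 1)) : Sentence :=
  closure (imp (all (iff φ (neg ψ))) (exSet (all (iff (mem (.var 0) 0) φ.liftSet))))

end Formula

open Formula Term in
/-- Robinson arithmetic with inequality. -/
def robinson : Theory :=
  { all (neg (eq (succ (var 0)) zero)),
    all (all (imp (eq (succ (var 1)) (succ (var 0))) (eq (var 1) (var 0)))),
    all (imp (neg (eq (var 0) zero)) (ex (eq (var 1) (succ (var 0))))),
    all (eq (add (var 0) zero) (var 0)),
    all (all (eq (add (var 1) (succ (var 0))) (succ (add (var 1) (var 0))))),
    all (eq (mul (var 0) zero) zero),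
    all (all (eq (mul (var 1) (succ (var 0))) (add (mul (var 1) (var 0)) (var 1)))),
    all (all (iff (lt (var 1) (var 0)) (ex (eq (add (var 2) (succ (var 0))) (var 1))))) }

/-- `RCA₀`: Robinson arithmetic, `Σ⁰₁` induction, and recursive (`Δ⁰₁`) comprehension. -/
def RCA₀ : Theory :=
  robinson
    ∪ {θ | ∃ (k n : ℕ) (φ : Formula k (n + 1)), φ.IsSigma1 ∧ θ = φ.induction}
    ∪ {θ | ∃ (k n : ℕ) (φ ψ : Formula k (n + 1)),
        φ.IsSigma1 ∧ ψ.IsSigma1 ∧ θ = φ.comprehension ψ}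

/-! ### Structures and logical consequence -/

/-- A two-sorted structure for the language of second-order arithmetic. Both sorts are arbitrary
nonempty domains; the second sort need not contain all subsets of the first. -/
structure Model where
  Num : Type u
  Sets : Type v
  zero : Num
  succ : Num → Num
  add : Num → Num → Num
  mul : Num → Num → Num
  lt : Num → Num → Prop
  mem : Num → Sets → Prop
  sets_nonempty : Nonempty Sets

/-- The value of a term. -/
def Term.eval (M : Model.{u, v}) {n : ℕ} (x : Fin n → M.Num) : Term n → M.Num
  | var i => x i
  | zero => M.zero
  | succ t => M.succ (t.eval M x)
  | add s t => M.add (s.eval M x) (t.eval M x)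
  | mul s t => M.mul (s.eval M x) (t.eval M x)

/-- Satisfaction of a formula under an assignment of its set and number variables. -/
def Formula.Holds (M : Model.{u, v}) :
    {k n : ℕ} → (Fin k → M.Sets) → (Fin n → M.Num) → Formula k n → Prop
  | _, _, _, x, eq s t => s.eval M x = t.eval M x
  | _, _, _, x, lt s t => M.lt (s.eval M x) (t.eval M x)
  | _, _, X, x, mem t i => M.mem (t.eval M x) (X i)
  | _, _, X, x, neg φ => ¬ φ.Holds M X x
  | _, _, X, x, and φ ψ => φ.Holds M X x ∧ ψ.Holds M X x
  | _, _, X, x, or φ ψ => φ.Holds M X x ∨ ψ.Holds M X x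
  | _, _, X, x, all φ => ∀ a : M.Num, φ.Holds M X (Fin.cons a x)
  | _, _, X, x, ex φ => ∃ a : M.Num, φ.Holds M X (Fin.cons a x)
  | _, _, X, x, allSet φ => ∀ A : M.Sets, φ.Holds M (Fin.cons A X) x
  | _, _, X, x, exSet φ => ∃ A : M.Sets, φ.Holds M (Fin.cons A X) x

/-- Truth of a sentence in a structure. -/
def Model.Satisfies (M : Model.{u, v}) (θ : Sentence) : Prop :=
  θ.Holds M Fin.elim0 Fin.elim0

/-- `T ⊢ θ`: the sentence `θ` is a logical consequence of `T` in two-sorted first-order logic. -/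
def Proves (T : Theory) (θ : Sentence) : Prop :=
  ∀ M : Model.{u, v}, (∀ χ ∈ T, M.Satisfies χ) → M.Satisfies θ

/-! ### The additive Ramsey theorem as a sentence

A finite semigroup `S` with a numbering `e : S ≃ Fin s` is presented inside arithmetic by the
numbers below `s`, and its multiplication by a finite multiplication table. A colouring `C` of
pairs `i < j` is a set of codes `⟨⟨i, j⟩, c⟩`. -/

namespace Formula

variable {k n : ℕ}

/-- `C(i, j) = c`, i.e. `⟨⟨i, j⟩, c⟩ ∈ C`. -/
def colourEq (C : Fin k) (i j c : Term n) : Formula k n :=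
  mem (Term.pair (Term.pair i j) c) C

/-- `C` is a function from `{(i, j) | i < j}` to `{0, …, s - 1}`: every element of `C` has the
form `⟨⟨i, j⟩, c⟩` with `i < j` and `c < s`, and for all `i < j` there is exactly one `c < s`
with `⟨⟨i, j⟩, c⟩ ∈ C`. -/
def isColouring (s : ℕ) (C : Fin k) : Formula k 0 :=
  and
    -- the variables are `z = 3, i = 2, j = 1, c = 0`
    (all (imp (mem (.var 0) C)
      (ex (ex (ex (and (and (lt (.var 2) (.var 1)) (lt (.var 0) (.numeral s)))
        (eq (.var 3) (Term.pair (Term.pair (.var 2) (.var 1)) (.var 0)))))))))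
    -- the variables are `i = 3, j = 2, c = 1, d = 0`
    (all (all (imp (lt (.var 1) (.var 0))
      (ex (and (and (lt (.var 0) (.numeral s)) (colourEq C (.var 2) (.var 1) (.var 0)))
        (all (imp (and (lt (.var 0) (.numeral s)) (colourEq C (.var 3) (.var 2) (.var 0)))
          (eq (.var 0) (.var 1)))))))))

/-- `x • y = z` in the semigroup `S`: the disjunction over all `a, b ∈ S` of
`x = a ∧ y = b ∧ z = a • b`. -/
def mulTable {S : Type w} [Mul S] {s : ℕ} (e : S ≃ Fin s) (x y z : Term n) : Formula k n :=
  disj ((List.finRange s ×ˢ List.finRange s).map fun p =>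
    and (and (eq x (.numeral p.1)) (eq y (.numeral p.2)))
      (eq z (.numeral (e (e.symm p.1 * e.symm p.2)))))

/-- `C` is additive: `C(i, j) • C(j, l) = C(i, l)` whenever `i < j < l`. -/
def isAdditive {S : Type w} [Mul S] {s : ℕ} (e : S ≃ Fin s) (C : Fin k) : Formula k 0 :=
  -- the variables are `i = 5, j = 4, l = 3, x = 2, y = 1, z = 0`
  all (all (all (all (all (all (imp
    (and (and (lt (.var 5) (.var 4)) (lt (.var 4) (.var 3)))
      (and (and (colourEq C (.var 5) (.var 4) (.var 2)) (colourEq C (.var 4) (.var 3) (.var 1)))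
        (colourEq C (.var 5) (.var 3) (.var 0))))
    (mulTable e (.var 2) (.var 1) (.var 0))))))))

/-- `I` is infinite (unbounded). -/
def isInfinite (I : Fin k) : Formula k n :=
  all (ex (and (lt (.var 1) (.var 0)) (mem (.var 0) I)))

/-- `I` is an `a`-clique under `C`: `C(i, j) = a` for all `i < j` in `I`. -/
def isClique (C I : Fin k) (a : Term n) : Formula k n :=
  all (all (imp (and (and (mem (.var 1) I) (mem (.var 0) I)) (lt (.var 1) (.var 0)))
    (colourEq C (.var 1) (.var 0) a.lift.lift)))

/-- The sentence: for every additive colouring `C` of pairs into `S` there are `a ∈ S` and a set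
`I` such that `I` is an infinite `a`-clique. -/
def additiveRamsey {S : Type w} [Mul S] {s : ℕ} (e : S ≃ Fin s) : Sentence :=
  -- `C` is the set variable `0`, and the set variable `1` under the quantifier for `I`
  allSet (imp (and (isColouring s 0) (isAdditive e 0))
    (exLT (.numeral s) (exSet (and (isInfinite 0) (isClique 1 0 (.var 0))))))

end Formula

end SOArith

namespace SOArith

/-! ### Semantics of substitution and of universal closure -/

theorem Term.eval_subst (M : Model.{u, v}) {n m : ℕ} (σ : Fin n → Term m) (x : Fin m → M.Num)
    (t : Term n) : (t.subst σ).eval M x = t.eval M (fun i => (σ i).eval M x) := by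
  induction t with
  | var i => rfl
  | zero => rfl
  | succ t ih => simp [Term.subst, Term.eval, ih]
  | add s t ihs iht => simp [Term.subst, Term.eval, ihs, iht]
  | mul s t ihs iht => simp [Term.subst, Term.eval, ihs, iht]

theorem Term.eval_lift (M : Model.{u, v}) {n : ℕ} (x : Fin n → M.Num) (a : M.Num) (t : Term n) :
    t.lift.eval M (Fin.cons a x : Fin (n + 1) → M.Num) = t.eval M x := by
  simp [Term.lift, Term.eval_subst, Term.eval]

theorem eval_cons_lift (M : Model.{u, v}) {n m : ℕ} (σ : Fin n → Term m) (x : Fin m → M.Num)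
    (a : M.Num) :
    (fun i => Term.eval M (Fin.cons a x : Fin (m + 1) → M.Num)
      ((Fin.cons (.var 0) fun i => (σ i).lift : Fin (n + 1) → Term (m + 1)) i)) =
      Fin.cons a fun i => (σ i).eval M x := by
  funext i
  refine Fin.cases ?_ (fun i => ?_) i
  · rfl
  · simp [Term.eval_lift]

theorem cons_comp_cons_succ {α : Type*} {k l : ℕ} (τ : Fin k → Fin l) (X : Fin l → α) (A : α) :
    (fun i => (Fin.cons A X : Fin (l + 1) → α)
      ((Fin.cons 0 fun j => (τ j).succ : Fin (k + 1) → Fin (l + 1)) i)) =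
      Fin.cons A fun i => X (τ i) := by
  funext i
  refine Fin.cases ?_ (fun i => ?_) i <;> simp

/-- The substitutions and assignments are quantified inside the induction because passing under a
binder changes them. -/
theorem Formula.holds_subst (M : Model.{u, v}) {k n : ℕ} (φ : Formula k n) :
    ∀ {l m : ℕ} (τ : Fin k → Fin l) (σ : Fin n → Term m) (X : Fin l → M.Sets) (x : Fin m → M.Num),
      (φ.subst τ σ).Holds M X x ↔
        φ.Holds M (fun i => X (τ i)) (fun i => (σ i).eval M x) := by
  induction φ with
  | eq s t => intros; simp [Formula.subst, Formula.Holds, Term.eval_subst]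
  | lt s t => intros; simp [Formula.subst, Formula.Holds, Term.eval_subst]
  | mem t Y => intros; simp [Formula.subst, Formula.Holds, Term.eval_subst]
  | neg φ ih => intros; simp [Formula.subst, Formula.Holds, ih]
  | and φ ψ ih₁ ih₂ => intros; simp [Formula.subst, Formula.Holds, ih₁, ih₂]
  | or φ ψ ih₁ ih₂ => intros; simp [Formula.subst, Formula.Holds, ih₁, ih₂]
  | all φ ih => intros; simp only [Formula.subst, Formula.Holds, ih, eval_cons_lift]
  | ex φ ih => intros; simp only [Formula.subst, Formula.Holds, ih, eval_cons_lift]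
  | allSet φ ih => intros; simp only [Formula.subst, Formula.Holds, ih, cons_comp_cons_succ]
  | exSet φ ih => intros; simp only [Formula.subst, Formula.Holds, ih, cons_comp_cons_succ]

theorem Formula.holds_imp (M : Model.{u, v}) {k n : ℕ} (φ ψ : Formula k n) (X : Fin k → M.Sets)
    (x : Fin n → M.Num) : (imp φ ψ).Holds M X x ↔ (φ.Holds M X x → ψ.Holds M X x) := by
  simp only [imp, Formula.Holds]
  tauto

theorem Formula.holds_iff (M : Model.{u, v}) {k n : ℕ} (φ ψ : Formula k n) (X : Fin k → M.Sets)
    (x : Fin n → M.Num) : (iff φ ψ).Holds M X x ↔ (φ.Holds M X x ↔ ψ.Holds M X x) := by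
  simp only [iff, holds_imp, Formula.Holds]
  tauto

theorem Formula.holds_disj (M : Model.{u, v}) {k n : ℕ} (L : List (Formula k n))
    (X : Fin k → M.Sets) (x : Fin n → M.Num) :
    (disj L).Holds M X x ↔ ∃ φ ∈ L, φ.Holds M X x := by
  induction L with
  | nil => simp [disj, Formula.Holds]
  | cons φ L ih => simp [disj, Formula.Holds, ih]

theorem Formula.holds_closeNum (M : Model.{u, v}) {k : ℕ} (X : Fin k → M.Sets)
    (x₀ : Fin 0 → M.Num) : ∀ {n : ℕ} (φ : Formula k n),
      φ.closeNum.Holds M X x₀ ↔ ∀ x, φ.Holds M X x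
  | 0, φ => ⟨fun h x => by rwa [Subsingleton.elim x x₀], fun h => h x₀⟩
  | n + 1, φ => by
    rw [closeNum, holds_closeNum M X x₀ (all φ)]
    exact ⟨fun h x => by simpa using h (Fin.tail x) (x 0), fun h x a => h _⟩

theorem Formula.holds_closeSet (M : Model.{u, v}) (X₀ : Fin 0 → M.Sets) (x₀ : Fin 0 → M.Num) :
    ∀ {k : ℕ} (φ : Formula k 0), φ.closeSet.Holds M X₀ x₀ ↔ ∀ X, φ.Holds M X x₀
  | 0, φ => ⟨fun h X => by rwa [Subsingleton.elim X X₀], fun h => h X₀⟩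
  | k + 1, φ => by
    rw [closeSet, holds_closeSet M X₀ x₀ (allSet φ)]
    exact ⟨fun h X => by simpa using h (Fin.tail X) (X 0), fun h X a => h _⟩

theorem satisfies_closure (M : Model.{u, v}) {k n : ℕ} (φ : Formula k n) :
    M.Satisfies φ.closure ↔ ∀ X x, φ.Holds M X x := by
  simp only [Model.Satisfies, Formula.closure, Formula.holds_closeSet, Formula.holds_closeNum]

/-! ### Definable functions and predicates -/

section Definability

variable {M : Model.{u, v}} {k n : ℕ}

/-- A function of number variables is the value of a term. -/
def IsTermFun (f : (Fin n → M.Num) → M.Num) : Prop :=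
  ∃ t : Term n, ∀ x, t.eval M x = f x

/-- A predicate of number variables is defined by a bounded formula with set parameters `X`. -/
def IsDelta0 (X : Fin k → M.Sets) (P : (Fin n → M.Num) → Prop) : Prop :=
  ∃ φ : Formula k n, φ.IsBounded ∧ ∀ x, φ.Holds M X x ↔ P x

/-- A predicate of number variables is defined by a `Σ⁰₁` formula with set parameters `X`. -/
def IsSigma1Pred (X : Fin k → M.Sets) (P : (Fin n → M.Num) → Prop) : Prop :=
  ∃ φ : Formula k n, φ.IsSigma1 ∧ ∀ x, φ.Holds M X x ↔ P x

theorem IsTermFun.var (i : Fin n) : IsTermFun (M := M) fun x => x i := ⟨.var i, fun _ => rfl⟩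

theorem IsTermFun.zero : IsTermFun (M := M) (n := n) fun _ => M.zero := ⟨.zero, fun _ => rfl⟩

theorem IsTermFun.succ {f : (Fin n → M.Num) → M.Num} (hf : IsTermFun f) :
    IsTermFun fun x => M.succ (f x) := by
  obtain ⟨s, hs⟩ := hf
  exact ⟨.succ s, fun x => by simp [Term.eval, hs]⟩

theorem IsTermFun.add' {f g : (Fin n → M.Num) → M.Num} (hf : IsTermFun f) (hg : IsTermFun g) :
    IsTermFun fun x => M.add (f x) (g x) := by
  obtain ⟨s, hs⟩ := hf
  obtain ⟨t, ht⟩ := hg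
  exact ⟨.add s t, fun x => by simp [Term.eval, hs, ht]⟩

theorem IsTermFun.mul' {f g : (Fin n → M.Num) → M.Num} (hf : IsTermFun f) (hg : IsTermFun g) :
    IsTermFun fun x => M.mul (f x) (g x) := by
  obtain ⟨s, hs⟩ := hf
  obtain ⟨t, ht⟩ := hg
  exact ⟨.mul s t, fun x => by simp [Term.eval, hs, ht]⟩

theorem IsTermFun.tail {f : (Fin n → M.Num) → M.Num} (hf : IsTermFun f) :
    IsTermFun fun x : Fin (n + 1) → M.Num => f (Fin.tail x) := by
  obtain ⟨t, ht⟩ := hf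
  exact ⟨t.lift, fun x => by simp [Term.lift, Term.eval_subst, Term.eval, ← ht, Fin.tail_def]⟩

variable {X : Fin k → M.Sets}

theorem IsDelta0.eq {f g : (Fin n → M.Num) → M.Num} (hf : IsTermFun f) (hg : IsTermFun g) :
    IsDelta0 X fun x => f x = g x := by
  obtain ⟨s, hs⟩ := hf
  obtain ⟨t, ht⟩ := hg
  exact ⟨.eq s t, .eq _ _, fun x => by simp [Formula.Holds, hs, ht]⟩

theorem IsDelta0.lt' {f g : (Fin n → M.Num) → M.Num} (hf : IsTermFun f) (hg : IsTermFun g) :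
    IsDelta0 X fun x => M.lt (f x) (g x) := by
  obtain ⟨s, hs⟩ := hf
  obtain ⟨t, ht⟩ := hg
  exact ⟨.lt s t, .lt _ _, fun x => by simp [Formula.Holds, hs, ht]⟩

theorem IsDelta0.mem {f : (Fin n → M.Num) → M.Num} (hf : IsTermFun f) (i : Fin k) :
    IsDelta0 X fun x => M.mem (f x) (X i) := by
  obtain ⟨s, hs⟩ := hf
  exact ⟨.mem s i, .mem _ _, fun x => by simp [Formula.Holds, hs]⟩

theorem IsDelta0.not {P : (Fin n → M.Num) → Prop} (hP : IsDelta0 X P) :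
    IsDelta0 X fun x => ¬ P x := by
  obtain ⟨φ, hφ, h⟩ := hP
  exact ⟨.neg φ, .neg hφ, fun x => by simp [Formula.Holds, h]⟩

theorem IsDelta0.and {P Q : (Fin n → M.Num) → Prop} (hP : IsDelta0 X P) (hQ : IsDelta0 X Q) :
    IsDelta0 X fun x => P x ∧ Q x := by
  obtain ⟨φ, hφ, h⟩ := hP
  obtain ⟨ψ, hψ, h'⟩ := hQ
  exact ⟨.and φ ψ, .and hφ hψ, fun x => by simp [Formula.Holds, h, h']⟩

theorem IsDelta0.or {P Q : (Fin n → M.Num) → Prop} (hP : IsDelta0 X P) (hQ : IsDelta0 X Q) :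
    IsDelta0 X fun x => P x ∨ Q x := by
  obtain ⟨φ, hφ, h⟩ := hP
  obtain ⟨ψ, hψ, h'⟩ := hQ
  exact ⟨.or φ ψ, .or hφ hψ, fun x => by simp [Formula.Holds, h, h']⟩

theorem IsDelta0.congr {P Q : (Fin n → M.Num) → Prop} (hP : IsDelta0 X P) (h : ∀ x, P x ↔ Q x) :
    IsDelta0 X Q := by
  rwa [← funext fun x => propext (h x)]

theorem IsDelta0.imp {P Q : (Fin n → M.Num) → Prop} (hP : IsDelta0 X P) (hQ : IsDelta0 X Q) :
    IsDelta0 X fun x => P x → Q x :=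
  (hP.not.or hQ).congr fun _ => imp_iff_not_or.symm

theorem IsDelta0.iff {P Q : (Fin n → M.Num) → Prop} (hP : IsDelta0 X P) (hQ : IsDelta0 X Q) :
    IsDelta0 X fun x => P x ↔ Q x :=
  ((hP.imp hQ).and (hQ.imp hP)).congr fun _ => iff_iff_implies_and_implies.symm

theorem IsDelta0.const (p : Prop) : IsDelta0 X fun _ : Fin n → M.Num => p := by
  have h : IsDelta0 X fun _ : Fin n → M.Num => M.zero = M.zero := .eq .zero .zero
  by_cases hp : p
  · exact h.congr fun _ => by simp [hp]
  · exact h.not.congr fun _ => by simp [hp]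

/-- The disjunction has standard finite length. Quantifiers over `S` and over equivalence classes
therefore stay inside bounded formulas. -/
theorem IsDelta0.exists_fintype {ι : Type*} [Finite ι] {P : ι → (Fin n → M.Num) → Prop}
    (hP : ∀ i, IsDelta0 X (P i)) : IsDelta0 X fun x => ∃ i, P i x := by
  cases nonempty_fintype ι
  classical
  have key (T : Finset ι) : IsDelta0 X fun x => ∃ i ∈ T, P i x := by
    induction T using Finset.induction_on with
    | empty => exact (IsDelta0.const False).congr fun _ => by simp
    | insert i T _ ih => exact ((hP i).or ih).congr fun _ => by simp
  exact (key Finset.univ).congr fun _ => by simp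

theorem IsDelta0.exLT' {f : (Fin n → M.Num) → M.Num} (hf : IsTermFun f)
    {P : M.Num → (Fin n → M.Num) → Prop}
    (hP : IsDelta0 X fun x : Fin (n + 1) → M.Num => P (x 0) (Fin.tail x)) :
    IsDelta0 X fun x => ∃ a, M.lt a (f x) ∧ P a x := by
  obtain ⟨t, ht⟩ := hf
  obtain ⟨φ, hφ, h⟩ := hP
  refine ⟨.exLT t φ, .exLT t hφ, fun x => ?_⟩
  simp [Formula.exLT, Formula.Holds, Term.eval_lift, h, ht, Term.eval]

theorem IsDelta0.allLT' {f : (Fin n → M.Num) → M.Num} (hf : IsTermFun f)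
    {P : M.Num → (Fin n → M.Num) → Prop}
    (hP : IsDelta0 X fun x : Fin (n + 1) → M.Num => P (x 0) (Fin.tail x)) :
    IsDelta0 X fun x => ∀ a, M.lt a (f x) → P a x := by
  obtain ⟨t, ht⟩ := hf
  obtain ⟨φ, hφ, h⟩ := hP
  refine ⟨.allLT t φ, .allLT t hφ, fun x => ?_⟩
  simp [Formula.allLT, Formula.holds_imp, Formula.Holds, Term.eval_lift, h, ht, Term.eval]

theorem IsDelta0.sigma1 {P : (Fin n → M.Num) → Prop} (hP : IsDelta0 X P) : IsSigma1Pred X P := by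
  obtain ⟨φ, hφ, h⟩ := hP
  exact ⟨φ, .bounded hφ, h⟩

theorem IsSigma1Pred.ex {P : M.Num → (Fin n → M.Num) → Prop}
    (hP : IsSigma1Pred X fun x : Fin (n + 1) → M.Num => P (x 0) (Fin.tail x)) :
    IsSigma1Pred X fun x => ∃ a, P a x := by
  obtain ⟨φ, hφ, h⟩ := hP
  exact ⟨.ex φ, .ex hφ, fun x => by simp [Formula.Holds, h]⟩

end Definability

/-! ### Models of `RCA₀` -/

/-- The structure `M` is a model of `RCA₀`. -/
class Model.IsRCA (M : Model.{u, v}) : Prop where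
  satisfies : ∀ χ ∈ RCA₀, M.Satisfies χ

section RCA

variable {M : Model.{u, v}} [hM : M.IsRCA] {k n : ℕ} {X : Fin k → M.Sets}

/-- Phrased for predicates instead of formulas, so that applications build definability from closure
properties and never write syntax. -/
theorem Model.sigma1_induction {P : (Fin (n + 1) → M.Num) → Prop} (hP : IsSigma1Pred X P)
    (x : Fin n → M.Num) (h0 : P (Fin.cons M.zero x))
    (hs : ∀ a, P (Fin.cons a x) → P (Fin.cons (M.succ a) x)) (a : M.Num) : P (Fin.cons a x) := by
  obtain ⟨φ, hφ, h⟩ := hP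
  have ax := hM.satisfies φ.induction (Or.inl (Or.inr ⟨k, n, φ, hφ, rfl⟩))
  rw [Formula.induction, satisfies_closure] at ax
  have ax := ax X x
  have e0 : (fun i => Term.eval M x ((Fin.cons .zero .var : Fin (n + 1) → Term n) i)) =
      Fin.cons M.zero x := by
    funext i
    refine Fin.cases rfl (fun i => rfl) i
  have es (a : M.Num) : (fun i => Term.eval M (Fin.cons a x : Fin (n + 1) → M.Num)
      ((Fin.cons (.succ (.var 0)) fun i => .var i.succ : Fin (n + 1) → Term (n + 1)) i)) =
      Fin.cons (M.succ a) x := by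
    funext i
    refine Fin.cases rfl (fun i => rfl) i
  simp only [Formula.holds_imp, Formula.Holds, Formula.substZero, Formula.substSucc,
    Formula.holds_subst, id, e0, es, h] at ax
  exact ax ⟨h0, hs⟩ a

theorem Model.delta1_comprehension {P Q : (Fin (n + 1) → M.Num) → Prop} (hP : IsSigma1Pred X P)
    (hQ : IsSigma1Pred X Q) (x : Fin n → M.Num)
    (hPQ : ∀ a, P (Fin.cons a x) ↔ ¬ Q (Fin.cons a x)) :
    ∃ A : M.Sets, ∀ a, M.mem a A ↔ P (Fin.cons a x) := by
  obtain ⟨φ, hφ, h⟩ := hP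
  obtain ⟨ψ, hψ, h'⟩ := hQ
  have ax := hM.satisfies (φ.comprehension ψ) (Or.inr ⟨k, n, φ, ψ, hφ, hψ, rfl⟩)
  rw [Formula.comprehension, satisfies_closure] at ax
  have ax := ax X x
  simp only [Formula.holds_imp, Formula.holds_iff, Formula.Holds, Formula.liftSet,
    Formula.holds_subst, Fin.cons_succ, Term.eval, Fin.cons_zero, h, h'] at ax
  exact ax hPQ

end RCA

/-! ### Arithmetic in models of `RCA₀` -/

section TermFunctions

variable {M : Model.{u, v}} {n : ℕ} {f g : (Fin n → M.Num) → M.Num}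

namespace Model

instance : Zero M.Num := ⟨M.zero⟩

instance : One M.Num := ⟨M.succ M.zero⟩

instance : Add M.Num := ⟨M.add⟩

instance : Mul M.Num := ⟨M.mul⟩

theorem zero_def : M.zero = (0 : M.Num) := rfl

theorem add_def (a b : M.Num) : M.add a b = a + b := rfl

/-- The value of the pairing term. -/
def pair (a b : M.Num) : M.Num := (a + b) * (a + b) + a

theorem eval_pair {n : ℕ} (x : Fin n → M.Num) (s t : Term n) :
    (Term.pair s t).eval M x = pair (s.eval M x) (t.eval M x) := rfl

end Model

theorem IsTermFun.add (hf : IsTermFun f) (hg : IsTermFun g) : IsTermFun fun x => f x + g x :=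
  hf.add' hg

theorem IsTermFun.mul (hf : IsTermFun f) (hg : IsTermFun g) : IsTermFun fun x => f x * g x :=
  hf.mul' hg

theorem IsTermFun.one : IsTermFun (M := M) (n := n) fun _ => (1 : M.Num) :=
  IsTermFun.zero.succ

theorem IsTermFun.pair (hf : IsTermFun f) (hg : IsTermFun g) :
    IsTermFun fun x => Model.pair (f x) (g x) :=
  ((hf.add hg).mul (hf.add hg)).add hf

end TermFunctions

namespace Model

variable {M : Model.{u, v}} [hM : M.IsRCA]

theorem satisfies_of_mem_robinson {χ : Sentence} (h : χ ∈ robinson) : M.Satisfies χ :=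
  hM.satisfies χ (Or.inl (Or.inl h))

theorem succ_ne_zero' (a : M.Num) : M.succ a ≠ M.zero :=
  M.satisfies_of_mem_robinson (Or.inl rfl) a

theorem succ_inj' {a b : M.Num} (h : M.succ a = M.succ b) : a = b := by
  have := M.satisfies_of_mem_robinson (Or.inr (Or.inl rfl)) a b
  simp only [Formula.holds_imp] at this
  exact this h

theorem exists_eq_succ' {a : M.Num} (h : a ≠ M.zero) : ∃ b, a = M.succ b := by
  have := M.satisfies_of_mem_robinson (Or.inr (Or.inr (Or.inl rfl))) a
  simp only [Formula.holds_imp] at this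
  exact this h

theorem add_zero' (a : M.Num) : M.add a M.zero = a :=
  M.satisfies_of_mem_robinson (Or.inr (Or.inr (Or.inr (Or.inl rfl)))) a

theorem add_succ' (a b : M.Num) : M.add a (M.succ b) = M.succ (M.add a b) :=
  M.satisfies_of_mem_robinson (Or.inr (Or.inr (Or.inr (Or.inr (Or.inl rfl))))) a b

theorem mul_zero' (a : M.Num) : M.mul a M.zero = M.zero :=
  M.satisfies_of_mem_robinson (Or.inr (Or.inr (Or.inr (Or.inr (Or.inr (Or.inl rfl)))))) a

theorem mul_succ' (a b : M.Num) : M.mul a (M.succ b) = M.add (M.mul a b) a :=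
  M.satisfies_of_mem_robinson (Or.inr (Or.inr (Or.inr (Or.inr (Or.inr (Or.inr (Or.inl rfl))))))) a b

theorem lt_iff' (a b : M.Num) : M.lt a b ↔ ∃ c, M.add a (M.succ c) = b := by
  have := M.satisfies_of_mem_robinson
    (Or.inr (Or.inr (Or.inr (Or.inr (Or.inr (Or.inr (Or.inr rfl))))))) a b
  simp only [Formula.holds_iff] at this
  exact this

/-- Induction for equations between terms. -/
theorem eq_induction {n : ℕ} {f g : (Fin (n + 1) → M.Num) → M.Num} (hf : IsTermFun f)
    (hg : IsTermFun g) (x : Fin n → M.Num)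
    (h0 : f (Fin.cons M.zero x) = g (Fin.cons M.zero x))
    (hs : ∀ a, f (Fin.cons a x) = g (Fin.cons a x) →
      f (Fin.cons (M.succ a) x) = g (Fin.cons (M.succ a) x)) (a : M.Num) :
    f (Fin.cons a x) = g (Fin.cons a x) := by
  -- `A` does not occur in the equation; it only fills the tuple of set parameters.
  have ⟨A⟩ := M.sets_nonempty
  exact sigma1_induction (X := ![A]) (IsDelta0.eq hf hg).sigma1 x h0 hs a

/-! ### The commutative semiring laws. -/

theorem zero_add' (a : M.Num) : M.add M.zero a = a :=
  eq_induction (f := fun x => M.add M.zero (x 0)) (g := fun x => x 0) (.add' .zero (.var 0))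
    (.var 0) ![] (add_zero' _) (fun a (h : M.add M.zero a = a) => by
      change M.add M.zero (M.succ a) = M.succ a
      rw [add_succ', h]) a

theorem succ_add' (b a : M.Num) : M.add (M.succ b) a = M.succ (M.add b a) :=
  eq_induction (f := fun x => M.add (M.succ (x 1)) (x 0)) (g := fun x => M.succ (M.add (x 1) (x 0)))
    (.add' (.succ (.var 1)) (.var 0)) (.succ (.add' (.var 1) (.var 0))) ![b]
    (by
      change M.add (M.succ b) M.zero = M.succ (M.add b M.zero)
      rw [add_zero', add_zero'])
    (fun a (h : M.add (M.succ b) a = M.succ (M.add b a)) => by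
      change M.add (M.succ b) (M.succ a) = M.succ (M.add b (M.succ a))
      rw [add_succ', h, add_succ']) a

theorem add_comm' (b a : M.Num) : M.add b a = M.add a b :=
  eq_induction (f := fun x => M.add (x 1) (x 0)) (g := fun x => M.add (x 0) (x 1))
    (.add' (.var 1) (.var 0)) (.add' (.var 0) (.var 1)) ![b]
    (by
      change M.add b M.zero = M.add M.zero b
      rw [add_zero', zero_add'])
    (fun a (h : M.add b a = M.add a b) => by
      change M.add b (M.succ a) = M.add (M.succ a) b
      rw [add_succ', h, succ_add']) a

theorem add_assoc' (b c a : M.Num) : M.add (M.add b c) a = M.add b (M.add c a) :=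
  eq_induction (f := fun x => M.add (M.add (x 1) (x 2)) (x 0))
    (g := fun x => M.add (x 1) (M.add (x 2) (x 0)))
    (.add' (.add' (.var 1) (.var 2)) (.var 0)) (.add' (.var 1) (.add' (.var 2) (.var 0))) ![b, c]
    (by
      change M.add (M.add b c) M.zero = M.add b (M.add c M.zero)
      rw [add_zero', add_zero'])
    (fun a (h : M.add (M.add b c) a = M.add b (M.add c a)) => by
      change M.add (M.add b c) (M.succ a) = M.add b (M.add c (M.succ a))
      rw [add_succ', h, add_succ', add_succ']) a

theorem zero_mul' (a : M.Num) : M.mul M.zero a = M.zero :=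
  eq_induction (f := fun x => M.mul M.zero (x 0)) (g := fun _ => M.zero) (.mul' .zero (.var 0))
    .zero ![] (mul_zero' _) (fun a (h : M.mul M.zero a = M.zero) => by
      change M.mul M.zero (M.succ a) = M.zero
      rw [mul_succ', h, add_zero']) a

theorem succ_mul' (b a : M.Num) : M.mul (M.succ b) a = M.add (M.mul b a) a :=
  eq_induction (f := fun x => M.mul (M.succ (x 1)) (x 0))
    (g := fun x => M.add (M.mul (x 1) (x 0)) (x 0))
    (.mul' (.succ (.var 1)) (.var 0)) (.add' (.mul' (.var 1) (.var 0)) (.var 0)) ![b]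
    (by
      change M.mul (M.succ b) M.zero = M.add (M.mul b M.zero) M.zero
      rw [mul_zero', mul_zero', add_zero'])
    (fun a (h : M.mul (M.succ b) a = M.add (M.mul b a) a) => by
      change M.mul (M.succ b) (M.succ a) = M.add (M.mul b (M.succ a)) (M.succ a)
      rw [mul_succ', h, mul_succ', add_succ', add_succ', add_assoc', add_assoc', add_comm' a b]) a

theorem mul_comm' (b a : M.Num) : M.mul b a = M.mul a b :=
  eq_induction (f := fun x => M.mul (x 1) (x 0)) (g := fun x => M.mul (x 0) (x 1))
    (.mul' (.var 1) (.var 0)) (.mul' (.var 0) (.var 1)) ![b]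
    (by
      change M.mul b M.zero = M.mul M.zero b
      rw [mul_zero', zero_mul'])
    (fun a (h : M.mul b a = M.mul a b) => by
      change M.mul b (M.succ a) = M.mul (M.succ a) b
      rw [mul_succ', h, succ_mul']) a

theorem mul_add' (b c a : M.Num) : M.mul b (M.add c a) = M.add (M.mul b c) (M.mul b a) :=
  eq_induction (f := fun x => M.mul (x 1) (M.add (x 2) (x 0)))
    (g := fun x => M.add (M.mul (x 1) (x 2)) (M.mul (x 1) (x 0)))
    (.mul' (.var 1) (.add' (.var 2) (.var 0)))
    (.add' (.mul' (.var 1) (.var 2)) (.mul' (.var 1) (.var 0))) ![b, c]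
    (by
      change M.mul b (M.add c M.zero) = M.add (M.mul b c) (M.mul b M.zero)
      rw [add_zero', mul_zero', add_zero'])
    (fun a (h : M.mul b (M.add c a) = M.add (M.mul b c) (M.mul b a)) => by
      change M.mul b (M.add c (M.succ a)) = M.add (M.mul b c) (M.mul b (M.succ a))
      rw [add_succ', mul_succ', h, mul_succ', add_assoc']) a

theorem mul_assoc' (b c a : M.Num) : M.mul (M.mul b c) a = M.mul b (M.mul c a) :=
  eq_induction (f := fun x => M.mul (M.mul (x 1) (x 2)) (x 0))
    (g := fun x => M.mul (x 1) (M.mul (x 2) (x 0)))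
    (.mul' (.mul' (.var 1) (.var 2)) (.var 0)) (.mul' (.var 1) (.mul' (.var 2) (.var 0))) ![b, c]
    (by
      change M.mul (M.mul b c) M.zero = M.mul b (M.mul c M.zero)
      rw [mul_zero', mul_zero', mul_zero'])
    (fun a (h : M.mul (M.mul b c) a = M.mul b (M.mul c a)) => by
      change M.mul (M.mul b c) (M.succ a) = M.mul b (M.mul c (M.succ a))
      rw [mul_succ', h, mul_succ', mul_add']) a

theorem mul_one' (a : M.Num) : M.mul a (M.succ M.zero) = a := by
  rw [mul_succ', mul_zero', zero_add']

instance : CommSemiring M.Num where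
  add_assoc := add_assoc'
  zero_add := zero_add'
  add_zero := add_zero'
  add_comm := add_comm'
  mul_assoc := mul_assoc'
  one_mul a := by
    change M.mul (M.succ M.zero) a = a
    rw [mul_comm', mul_one']
  mul_one := mul_one'
  mul_comm := mul_comm'
  zero_mul := zero_mul'
  mul_zero := mul_zero'
  left_distrib := mul_add'
  right_distrib a b c := by
    change M.mul (M.add a b) c = M.add (M.mul a c) (M.mul b c)
    rw [mul_comm', mul_add', mul_comm' c a, mul_comm' c b]
  nsmul := nsmulRec
  npow := npowRec

/-! ### Cancellation, linear order and standard numerals. -/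

theorem succ_def (a : M.Num) : M.succ a = a + 1 := by
  change _ = M.add a (M.succ M.zero)
  rw [add_succ', add_zero']

theorem add_one_ne_zero (a : M.Num) : a + 1 ≠ 0 := by
  rw [← succ_def]
  exact succ_ne_zero' a

theorem add_one_inj {a b : M.Num} (h : a + 1 = b + 1) : a = b := by
  rw [← succ_def, ← succ_def] at h
  exact succ_inj' h

theorem exists_eq_add_one {a : M.Num} (h : a ≠ 0) : ∃ b, a = b + 1 := by
  simp_rw [← succ_def]
  exact exists_eq_succ' h

theorem num_add_left_cancel (b c a : M.Num) : a + b = a + c → b = c := by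
  have ⟨A⟩ := M.sets_nonempty
  refine sigma1_induction (X := ![A]) (P := fun x => x 0 + x 1 = x 0 + x 2 → x 1 = x 2)
    (IsDelta0.imp (.eq (.add' (.var 0) (.var 1)) (.add' (.var 0) (.var 2)))
      (.eq (.var 1) (.var 2))).sigma1 ![b, c] ?_ (fun a ih => ?_) a
  · change 0 + b = 0 + c → b = c
    simp
  · change a + b = a + c → b = c at ih
    change M.succ a + b = M.succ a + c → b = c
    rw [succ_def]
    intro h
    refine ih (add_one_inj ?_)
    rw [add_right_comm, h, add_right_comm]

theorem lt_iff_exists_add (a b : M.Num) : M.lt a b ↔ ∃ c, a + c + 1 = b := by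
  rw [lt_iff']
  simp_rw [add_def, succ_def, add_assoc]

theorem not_lt_self (a : M.Num) : ¬ M.lt a a := by
  rw [lt_iff_exists_add]
  rintro ⟨c, hc⟩
  refine add_one_ne_zero c (num_add_left_cancel _ _ a ?_)
  rw [← add_assoc, hc, add_zero]

theorem lt_trans' {a b c : M.Num} (h : M.lt a b) (h' : M.lt b c) : M.lt a c := by
  rw [lt_iff_exists_add] at *
  obtain ⟨d, rfl⟩ := h
  obtain ⟨e, rfl⟩ := h'
  exact ⟨d + 1 + e, by ring⟩

theorem lt_trichotomy' (b a : M.Num) : M.lt a b ∨ a = b ∨ M.lt b a := by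
  have ⟨A⟩ := M.sets_nonempty
  refine sigma1_induction (X := ![A])
    (P := fun x => M.lt (x 0) (x 1) ∨ x 0 = x 1 ∨ M.lt (x 1) (x 0))
    (IsDelta0.or (.lt' (.var 0) (.var 1)) (.or (.eq (.var 0) (.var 1))
      (.lt' (.var 1) (.var 0)))).sigma1 ![b] ?_ (fun a ih => ?_) a
  · change M.lt 0 b ∨ 0 = b ∨ M.lt b 0
    by_cases hb : b = 0
    · exact Or.inr (Or.inl hb.symm)
    · obtain ⟨c, rfl⟩ := exists_eq_add_one hb
      exact Or.inl ((lt_iff_exists_add _ _).2 ⟨c, by ring⟩)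
  · change M.lt a b ∨ a = b ∨ M.lt b a at ih
    change M.lt (M.succ a) b ∨ M.succ a = b ∨ M.lt b (M.succ a)
    rw [succ_def]
    simp only [lt_iff_exists_add] at ih ⊢
    obtain ⟨c, rfl⟩ | rfl | ⟨c, rfl⟩ := ih
    · by_cases hc : c = 0
      · exact Or.inr (Or.inl (by rw [hc, add_zero]))
      · obtain ⟨d, rfl⟩ := exists_eq_add_one hc
        exact Or.inl ⟨d, by ring⟩
    · exact Or.inr (Or.inr ⟨0, by ring⟩)
    · exact Or.inr (Or.inr ⟨c + 1, by ring⟩)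

open Classical in
noncomputable instance : LinearOrder M.Num where
  lt := M.lt
  le a b := M.lt a b ∨ a = b
  le_refl a := Or.inr rfl
  le_trans := by
    rintro a b c (h | rfl) (h' | rfl)
    · exact Or.inl (lt_trans' h h')
    · exact Or.inl h
    · exact Or.inl h'
    · exact Or.inr rfl
  lt_iff_le_not_ge := by
    refine fun a b => ⟨fun h => ⟨Or.inl h, ?_⟩, fun ⟨h, h'⟩ => ?_⟩
    · rintro (h' | rfl)
      · exact not_lt_self _ (lt_trans' h h')
      · exact not_lt_self _ h
    · obtain h | rfl := h
      · exact h
      · exact absurd (Or.inr rfl) h'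
  le_antisymm := by
    rintro a b (h | rfl) (h' | h')
    · exact absurd (lt_trans' h h') (not_lt_self _)
    · exact h'.symm
    · rfl
    · rfl
  le_total a b := by
    rcases lt_trichotomy' b a with h | h | h
    · exact Or.inl (Or.inl h)
    · exact Or.inl (Or.inr h)
    · exact Or.inr (Or.inl h)
  toDecidableLE := Classical.decRel _

theorem lt_def (a b : M.Num) : M.lt a b ↔ a < b := Iff.rfl

theorem num_lt_iff {a b : M.Num} : a < b ↔ ∃ c, b = a + c + 1 := by
  simp_rw [← lt_def, lt_iff_exists_add, eq_comm]

theorem num_le_iff {a b : M.Num} : a ≤ b ↔ ∃ c, b = a + c := by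
  rw [le_iff_lt_or_eq, num_lt_iff]
  constructor
  · rintro (⟨c, rfl⟩ | rfl)
    · exact ⟨c + 1, by ring⟩
    · exact ⟨0, by ring⟩
  · rintro ⟨c, rfl⟩
    by_cases hc : c = 0
    · exact Or.inr (by rw [hc, add_zero])
    · obtain ⟨d, rfl⟩ := exists_eq_add_one hc
      exact Or.inl ⟨d, by ring⟩

instance : CanonicallyOrderedAdd M.Num where
  exists_add_of_le h := num_le_iff.1 h
  le_add_self a b := num_le_iff.2 ⟨b, add_comm b a⟩
  le_self_add _ b := num_le_iff.2 ⟨b, rfl⟩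

instance : Nontrivial M.Num := ⟨0, 0 + 1, (add_one_ne_zero 0).symm⟩

instance : IsStrictOrderedRing M.Num where
  add_le_add_left _ _ h c := by
    obtain ⟨d, rfl⟩ := num_le_iff.1 h
    exact num_le_iff.2 ⟨d, by ring⟩
  le_of_add_le_add_left a _ _ h := by
    obtain ⟨d, hd⟩ := num_le_iff.1 h
    rw [add_assoc] at hd
    exact num_le_iff.2 ⟨d, num_add_left_cancel _ _ _ hd⟩
  zero_le_one := zero_le
  mul_lt_mul_of_pos_left _ ha _ _ h := by
    obtain ⟨d, rfl⟩ := num_lt_iff.1 ha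
    obtain ⟨e, rfl⟩ := num_lt_iff.1 h
    exact num_lt_iff.2 ⟨e + d * e + d, by ring⟩
  mul_lt_mul_of_pos_right _ ha _ _ h := by
    obtain ⟨d, rfl⟩ := num_lt_iff.1 ha
    obtain ⟨e, rfl⟩ := num_lt_iff.1 h
    exact num_lt_iff.2 ⟨e + d * e + d, by ring⟩

theorem num_lt_add_one_iff {a b : M.Num} : a < b + 1 ↔ a ≤ b := by
  rw [num_lt_iff, num_le_iff]
  exact ⟨fun ⟨c, hc⟩ => ⟨c, add_one_inj hc⟩, fun ⟨c, hc⟩ => ⟨c, by rw [hc]⟩⟩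

theorem eval_numeral {n : ℕ} (x : Fin n → M.Num) (m : ℕ) :
    (Term.numeral m : Term n).eval M x = (m : M.Num) := by
  induction m with
  | zero => simp [Term.numeral, Term.eval, zero_def]
  | succ m ih => simp [Term.numeral, Term.eval, succ_def, ih]

/-- Below a standard number there are no nonstandard ones; this lets colour codes in the model be
decoded to elements of `S`. The induction on `m` is external. -/
theorem eq_natCast_of_lt {m : ℕ} {a : M.Num} (h : a < (m : M.Num)) : ∃ i < m, a = (i : M.Num) := by
  induction m with
  | zero => simp at h
  | succ m ih =>
    rw [Nat.cast_succ, num_lt_add_one_iff] at h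
    obtain rfl | h := h.eq_or_lt
    · exact ⟨m, by simp, rfl⟩
    · obtain ⟨i, hi, rfl⟩ := ih h
      exact ⟨i, hi.trans m.lt_succ_self, rfl⟩

end Model

section Definability

variable {M : Model.{u, v}} [M.IsRCA] {k n : ℕ} {X : Fin k → M.Sets}
  {f g : (Fin n → M.Num) → M.Num}

theorem IsTermFun.natCast (m : ℕ) : IsTermFun (M := M) (n := n) fun _ => (m : M.Num) :=
  ⟨.numeral m, fun _ => Model.eval_numeral _ _⟩

theorem IsDelta0.lt (hf : IsTermFun f) (hg : IsTermFun g) : IsDelta0 X fun x => f x < g x :=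
  .lt' hf hg

theorem IsDelta0.exLT (hf : IsTermFun f) {P : M.Num → (Fin n → M.Num) → Prop}
    (hP : IsDelta0 X fun x : Fin (n + 1) → M.Num => P (x 0) (Fin.tail x)) :
    IsDelta0 X fun x => ∃ a < f x, P a x :=
  .exLT' hf hP

theorem IsDelta0.allLT (hf : IsTermFun f) {P : M.Num → (Fin n → M.Num) → Prop}
    (hP : IsDelta0 X fun x : Fin (n + 1) → M.Num => P (x 0) (Fin.tail x)) :
    IsDelta0 X fun x => ∀ a < f x, P a x :=
  .allLT' hf hP

theorem Model.sigma1_induction_add_one {P : (Fin (n + 1) → M.Num) → Prop} (hP : IsSigma1Pred X P)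
    (x : Fin n → M.Num) (h0 : P (Fin.cons 0 x))
    (hs : ∀ a, P (Fin.cons a x) → P (Fin.cons (a + 1) x)) (a : M.Num) : P (Fin.cons a x) :=
  Model.sigma1_induction hP x h0 (fun a h => Model.succ_def a ▸ hs a h) a

end Definability

/-! ### Numbers coding finite sets -/

namespace Model

variable {M : Model.{u, v}} [hM : M.IsRCA]

/-- There is no subtraction, so the two quotients are compared: the difference is the new quotient,
or else `b = 0`. -/
theorem num_dvd_of_dvd_add {d a b : M.Num} (ha : d ∣ a) (h : d ∣ a + b) : d ∣ b := by
  obtain ⟨p, rfl⟩ := ha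
  obtain ⟨q, hq⟩ := h
  obtain hpq | hpq := le_total p q
  · obtain ⟨r, rfl⟩ := num_le_iff.1 hpq
    exact ⟨r, add_left_cancel (hq.trans (mul_add d p r))⟩
  · obtain ⟨r, rfl⟩ := num_le_iff.1 hpq
    have h0 : d * r + b = 0 := by
      refine add_left_cancel (a := d * q) ?_
      rw [add_zero, ← add_assoc, ← mul_add, hq]
    rw [add_eq_zero] at h0
    simp [h0.2]

/-- The moduli of the beta function. -/
def modulus (b x : M.Num) : M.Num := 1 + (x + 1) * b

/-- The number `x` belongs to the finite set coded by `(b, c)`. -/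
def InCode (b c x : M.Num) : Prop := modulus b x ∣ c

/-- The modulus is coprime to `b`: `(x + 1) * (w * b) + w` is `w` times the modulus. -/
theorem dvd_of_modulus_dvd_mul {b x w : M.Num} (h : modulus b x ∣ w * b) : modulus b x ∣ w := by
  refine num_dvd_of_dvd_add (h.mul_left (x + 1)) ⟨w, ?_⟩
  rw [modulus]
  ring

/-- Distinct moduli are coprime. They differ by `(e + 1) * b` with `e + 1` the distance of `x` and
`y`, so `modulus b x` divides `c * (e + 1) * b`. Cancel `b`, replace `e + 1` by its multiple `b`,
and cancel `b` again. -/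
theorem dvd_of_modulus_dvd_mul_modulus {b c n x y : M.Num} (hb : ∀ z < n, z + 1 ∣ b) (hx : x < n)
    (hy : y < n) (hxy : x ≠ y) (h : modulus b x ∣ c * modulus b y) : modulus b x ∣ c := by
  have key : ∃ e < n, modulus b x ∣ c * (e + 1) * b := by
    obtain hlt | hlt := hxy.lt_or_gt
    · obtain ⟨e, rfl⟩ := num_lt_iff.1 hlt
      refine ⟨e, lt_of_le_of_lt ?_ hy, num_dvd_of_dvd_add (Dvd.intro_left c rfl) ?_⟩
      · exact num_le_iff.2 ⟨x + 1, by ring⟩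
      · convert h using 1
        simp only [modulus]
        ring
    · obtain ⟨e, rfl⟩ := num_lt_iff.1 hlt
      refine ⟨e, lt_of_le_of_lt ?_ hx, num_dvd_of_dvd_add h ⟨c, ?_⟩⟩
      · exact num_le_iff.2 ⟨y + 1, by ring⟩
      · simp only [modulus]
        ring
  obtain ⟨e, he, hd⟩ := key
  exact dvd_of_modulus_dvd_mul ((dvd_of_modulus_dvd_mul hd).trans (mul_dvd_mul_left c (hb e he)))

/-- Bounding the quotient makes divisibility a bounded formula. -/
theorem num_dvd_iff_exists_lt {a b : M.Num} (ha : a ≠ 0) : a ∣ b ↔ ∃ q < b + 1, b = a * q := by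
  refine ⟨fun ⟨q, hq⟩ => ⟨q, ?_, hq⟩, fun ⟨q, _, hq⟩ => ⟨q, hq⟩⟩
  obtain ⟨d, rfl⟩ := exists_eq_add_one ha
  rw [num_lt_add_one_iff, num_le_iff]
  exact ⟨d * q, by rw [hq]; ring⟩

theorem modulus_ne_zero (b x : M.Num) : modulus b x ≠ 0 := by
  rw [modulus, add_comm]
  exact add_one_ne_zero _

end Model

open Model

variable {M : Model.{u, v}} [hM : M.IsRCA] {k n : ℕ} {X : Fin k → M.Sets}

theorem IsDelta0.inCode {f g h : (Fin n → M.Num) → M.Num} (hf : IsTermFun f) (hg : IsTermFun g)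
    (hh : IsTermFun h) : IsDelta0 X fun x => InCode (f x) (g x) (h x) := by
  refine IsDelta0.congr (P := fun x => ∃ q < g x + 1, g x = modulus (f x) (h x) * q)
    (.exLT (hg.add .one) (.eq hg.tail (.mul (.add .one (.mul (hh.tail.add .one) hf.tail))
      (.var 0)))) fun x => ?_
  exact (num_dvd_iff_exists_lt (modulus_ne_zero _ _)).symm

namespace Model

/-- Plays the role of a factorial, without defining one: the induction multiplies by `a + 1`.
Requiring `b ≠ 0` excludes the trivial multiple, for which all moduli would be `1`. -/
theorem exists_common_multiple (n : M.Num) : ∃ b : M.Num, b ≠ 0 ∧ ∀ x < n, x + 1 ∣ b := by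
  have ⟨A⟩ := M.sets_nonempty
  have h := sigma1_induction_add_one (X := ![A])
    (P := fun v => ∃ b, b ≠ 0 ∧ ∀ x < v 0, ∃ q < b + 1, b = (x + 1) * q)
    (.ex (IsDelta0.and (.not (.eq (.var 0) .zero)) (.allLT (.var 1) (.exLT (.add (.var 1) .one)
      (.eq (.var 2) (.mul (.add (.var 1) .one) (.var 0)))))).sigma1) ![]
    ⟨1, one_ne_zero, fun x hx => absurd hx not_lt_zero⟩ ?_ n
  · obtain ⟨b, hb, h⟩ := h
    exact ⟨b, hb, fun x hx => (num_dvd_iff_exists_lt (add_one_ne_zero x)).2 (h x hx)⟩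
  · rintro a ⟨b, hb, h⟩
    change ∀ x < a, _ at h
    change ∃ b : M.Num, b ≠ 0 ∧ ∀ x < a + 1, ∃ q < b + 1, b = (x + 1) * q
    simp only [← num_dvd_iff_exists_lt (add_one_ne_zero _)] at h ⊢
    refine ⟨b * (a + 1), mul_ne_zero hb (add_one_ne_zero a), fun x hx => ?_⟩
    obtain rfl | hx := (num_lt_add_one_iff.1 hx).eq_or_lt
    · exact dvd_mul_left _ _
    · exact (h x hx).mul_right _

/-- Every set agrees below `n` with a finite set that is coded by a number. -/
theorem exists_code (A : M.Sets) (n : M.Num) :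
    ∃ b c : M.Num, ∀ x < n, InCode b c x ↔ M.mem x A := by
  obtain ⟨b, hb0, hb⟩ := exists_common_multiple n
  -- The induction codes the part of `A` below `v 0`, while `n` and `b` stay fixed so that all
  -- moduli remain coprime.
  have h := sigma1_induction_add_one (X := ![A])
    (P := fun v => ∃ c, ∀ x < v 1, InCode (v 2) c x ↔ (x < v 0 ∧ M.mem x A))
    (.ex (IsDelta0.allLT (.var 2) (.iff (.inCode (.var 4) (.var 1) (.var 0))
      (.and (.lt (.var 0) (.var 2)) (.mem (.var 0) 0)))).sigma1) ![n, b] ?_ ?_ n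
  · obtain ⟨c, hc⟩ := h
    exact ⟨b, c, fun x hx => (hc x hx).trans (and_iff_right hx)⟩
  -- The empty set is coded by `1`, since every modulus exceeds `1`.
  · refine ⟨1, fun x _ => ⟨fun h => ?_, fun h => absurd h.1 not_lt_zero⟩⟩
    change InCode b 1 x at h
    obtain ⟨d, rfl⟩ := exists_eq_add_one hb0
    have h1 : modulus (d + 1) x ≤ 1 := by
      obtain ⟨q, hq⟩ := h
      have hq0 : q ≠ 0 := by
        rintro rfl
        simp at hq
      obtain ⟨r, rfl⟩ := exists_eq_add_one hq0
      exact num_le_iff.2 ⟨modulus (d + 1) x * r, hq.trans (by ring)⟩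
    refine absurd h1 (not_le.2 (num_lt_iff.2 ⟨x * d + x + d, ?_⟩))
    rw [modulus]
    ring
  · rintro k ⟨c, hc⟩
    change ∀ x < n, InCode b c x ↔ (x < k ∧ M.mem x A) at hc
    change ∃ c, ∀ x < n, InCode b c x ↔ (x < k + 1 ∧ M.mem x A)
    by_cases hk : k < n ∧ M.mem k A
    -- Multiplying by the modulus of `k` adds `k`; coprimality ensures that nothing else below `n`
    -- is added.
    · refine ⟨c * modulus b k, fun x hx => ?_⟩
      obtain rfl | hxk := eq_or_ne x k
      · exact iff_of_true (Dvd.intro_left c rfl) ⟨num_lt_add_one_iff.2 le_rfl, hk.2⟩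
      · rw [num_lt_add_one_iff, le_iff_lt_or_eq, or_iff_left hxk, ← hc x hx]
        exact ⟨dvd_of_modulus_dvd_mul_modulus hb hx hk.1 hxk, fun h => Dvd.dvd.mul_right h _⟩
    · refine ⟨c, fun x hx => ?_⟩
      rw [hc x hx, num_lt_add_one_iff, le_iff_lt_or_eq]
      refine and_congr_left fun hxA => (or_iff_left ?_).symm
      rintro rfl
      exact hk ⟨hx, hxA⟩

/-! ### Greedy subsets -/

/-- The finite set coded by `(b, c)` consists, below `n`, of those elements `x` of `A` such that
`⟨⟨y, x⟩, a⟩ ∈ C` for all its elements `y < x`. -/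
def IsGreedyCode (A C : M.Sets) (a b c n : M.Num) : Prop :=
  ∀ x < n, InCode b c x ↔
    M.mem x A ∧ ∀ y < x, InCode b c y → M.mem (Model.pair (Model.pair y x) a) C

theorem isDelta0_isGreedyCode {A C : M.Sets} :
    IsDelta0 ![A, C] fun v : Fin 4 → M.Num => IsGreedyCode A C (v 3) (v 1) (v 0) (v 2) :=
  .allLT (.var 2) (.iff (.inCode (.var 2) (.var 1) (.var 0)) (.and (.mem (.var 0) 0)
    (.allLT (.var 0) (.imp (.inCode (.var 3) (.var 2) (.var 0))
      (.mem (.pair (.pair (.var 0) (.var 1)) (.var 5)) 1)))))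

variable {A C : M.Sets} {a : M.Num}

theorem IsGreedyCode.mono {b c n m : M.Num} (h : IsGreedyCode A C a b c n) (hmn : m ≤ n) :
    IsGreedyCode A C a b c m :=
  fun x hx => h x (hx.trans_le hmn)

/-- Course-of-values induction: whether `x` is taken depends only on the elements below `x`. -/
theorem IsGreedyCode.inCode_congr {b c b' c' n : M.Num} (h : IsGreedyCode A C a b c n)
    (h' : IsGreedyCode A C a b' c' n) {x : M.Num} (hx : x < n) : InCode b c x ↔ InCode b' c' x := by
  have key := sigma1_induction_add_one (X := ![A])
    (P := fun v => ∀ x < v 0, x < v 1 → (InCode (v 2) (v 3) x ↔ InCode (v 4) (v 5) x))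
    (IsDelta0.allLT (.var 0) (.imp (.lt (.var 0) (.var 2)) (.iff
      (.inCode (.var 3) (.var 4) (.var 0)) (.inCode (.var 5) (.var 6) (.var 0))))).sigma1
    ![n, b, c, b', c'] (fun x hx => absurd hx not_lt_zero) (fun z ih x hxz hxn => ?_) n
  · exact key x hx hx
  · change ∀ x < z, x < n → (InCode b c x ↔ InCode b' c' x) at ih
    change x < z + 1 at hxz
    change x < n at hxn
    change InCode b c x ↔ InCode b' c' x
    rw [h x hxn, h' x hxn]
    refine and_congr_right fun _ => forall₂_congr fun y hy => ?_
    rw [ih y (hy.trans_le (num_lt_add_one_iff.1 hxz)) (hy.trans hxn)]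

/-- One step of the recursion applies the greedy rule relative to the old code, which fixes
membership up to and including `m`. The resulting set `B` is defined by a bounded formula, so its
part below `m + 1` can be coded afresh. -/
theorem exists_isGreedyCode (A C : M.Sets) (a n : M.Num) :
    ∃ b c : M.Num, IsGreedyCode A C a b c n := by
  refine sigma1_induction_add_one (X := ![A, C])
    (P := fun v => ∃ b c, IsGreedyCode A C (v 1) b c (v 0))
    (.ex (.ex isDelta0_isGreedyCode.sigma1)) ![a]
    ⟨0, 0, fun x hx => absurd hx not_lt_zero⟩ ?_ n
  rintro m ⟨b, c, h⟩
  change IsGreedyCode A C a b c m at h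
  change ∃ b c, IsGreedyCode A C a b c (m + 1)
  have hP : IsDelta0 ![A, C] fun v : Fin 4 → M.Num => M.mem (v 0) A ∧ ∀ y < v 0,
      InCode (v 1) (v 2) y → M.mem (Model.pair (Model.pair y (v 0)) (v 3)) C :=
    .and (.mem (.var 0) 0) (.allLT (.var 0) (.imp (.inCode (.var 2) (.var 3) (.var 0))
      (.mem (.pair (.pair (.var 0) (.var 1)) (.var 4)) 1)))
  obtain ⟨B, hB⟩ := delta1_comprehension hP.sigma1 hP.not.sigma1 ![b, c, a]
    fun _ => not_not.symm
  change ∀ x, M.mem x B ↔ (M.mem x A ∧ ∀ y < x, InCode b c y →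
    M.mem (Model.pair (Model.pair y x) a) C) at hB
  obtain ⟨b', c', h'⟩ := exists_code B (m + 1)
  have agree (x : M.Num) (hx : x < m) : InCode b' c' x ↔ InCode b c x := by
    rw [h' x (num_lt_add_one_iff.2 hx.le), hB, h x hx]
  refine ⟨b', c', fun x hx => ?_⟩
  rw [h' x hx, hB]
  refine and_congr_right fun _ => forall₂_congr fun y hy => ?_
  rw [agree y (hy.trans_le (num_lt_add_one_iff.1 hx))]

/-- The greedy subset of `A`: it contains `x ∈ A` whenever `⟨⟨y, x⟩, a⟩ ∈ C` for all its
elements `y < x`. -/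
theorem exists_greedy (A C : M.Sets) (a : M.Num) : ∃ G : M.Sets, ∀ x, M.mem x G ↔
    M.mem x A ∧ ∀ y < x, M.mem y G → M.mem (Model.pair (Model.pair y x) a) C := by
  have hG : IsDelta0 ![A, C] fun v : Fin 4 → M.Num =>
      IsGreedyCode A C (v 3) (v 1) (v 0) (v 2 + 1) :=
    .allLT (.add (.var 2) .one) (.iff (.inCode (.var 2) (.var 1) (.var 0)) (.and (.mem (.var 0) 0)
      (.allLT (.var 0) (.imp (.inCode (.var 3) (.var 2) (.var 0))
        (.mem (.pair (.pair (.var 0) (.var 1)) (.var 5)) 1)))))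
  have hI : IsDelta0 ![A, C] fun v : Fin 4 → M.Num => InCode (v 1) (v 0) (v 2) :=
    .inCode (.var 1) (.var 0) (.var 2)
  -- Codes up to `x + 1` exist and agree at `x`, so "some code contains `x`" is the negation of
  -- "some code omits `x`"; both are `Σ⁰₁`.
  obtain ⟨G, hmem⟩ := delta1_comprehension
    (P := fun v => ∃ b c, IsGreedyCode A C (v 1) b c (v 0 + 1) ∧ InCode b c (v 0))
    (Q := fun v => ∃ b c, IsGreedyCode A C (v 1) b c (v 0 + 1) ∧ ¬ InCode b c (v 0))
    (.ex (.ex (hG.and hI).sigma1)) (.ex (.ex (hG.and hI.not).sigma1)) ![a] (fun x => by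
      change (∃ b c, IsGreedyCode A C a b c (x + 1) ∧ InCode b c x) ↔
        ¬ ∃ b c, IsGreedyCode A C a b c (x + 1) ∧ ¬ InCode b c x
      have hx : x < x + 1 := num_lt_add_one_iff.2 le_rfl
      constructor
      · rintro ⟨b, c, h, hin⟩ ⟨b', c', h', hout⟩
        exact hout ((h.inCode_congr h' hx).1 hin)
      · intro hne
        obtain ⟨b, c, h⟩ := exists_isGreedyCode A C a (x + 1)
        exact ⟨b, c, h, by_contra fun hout => hne ⟨b, c, h, hout⟩⟩)
  change ∀ x, M.mem x G ↔ ∃ b c, IsGreedyCode A C a b c (x + 1) ∧ InCode b c x at hmem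
  have mem_iff {b c n x : M.Num} (h : IsGreedyCode A C a b c n) (hx : x < n) :
      M.mem x G ↔ InCode b c x := by
    have hx' : x < x + 1 := num_lt_add_one_iff.2 le_rfl
    have hxn : x + 1 ≤ n := by
      obtain ⟨d, rfl⟩ := num_lt_iff.1 hx
      exact num_le_iff.2 ⟨d, by ring⟩
    rw [hmem]
    refine ⟨fun ⟨b', c', h', hin⟩ => (h'.inCode_congr (h.mono hxn) hx').1 hin,
      fun hin => ⟨b, c, h.mono hxn, hin⟩⟩
  refine ⟨G, fun x => ?_⟩
  have hx : x < x + 1 := num_lt_add_one_iff.2 le_rfl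
  obtain ⟨b, c, h⟩ := exists_isGreedyCode A C a (x + 1)
  rw [mem_iff h hx, h x hx]
  refine and_congr_right fun _ => forall₂_congr fun y hy => ?_
  rw [mem_iff h (hy.trans hx)]

end Model

/-! ### Additive colourings in models of `RCA₀` -/

section Colouring

open Model

variable {M : Model.{u, v}} [hM : M.IsRCA] {S : Type w}

/-- In the colouring `C`, the pair `(i, j)` has the colour with code `c`. -/
def HasColour (C : M.Sets) (i j : M.Num) (c : ℕ) : Prop :=
  M.mem (Model.pair (Model.pair i j) (c : M.Num)) C

theorem IsDelta0.hasColour {k n : ℕ} {X : Fin k → M.Sets} {f g : (Fin n → M.Num) → M.Num}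
    (hf : IsTermFun f) (hg : IsTermFun g) (c : ℕ) (p : Fin k) :
    IsDelta0 X fun x => HasColour (X p) (f x) (g x) c :=
  .mem (.pair (.pair hf hg) (.natCast c)) p

/-- The set `C`, together with the coding `code` of the elements of the semigroup `S`, represents
the additive colouring `col` of pairs. -/
structure RepresentsAdditive [Mul S] (C : M.Sets) (code : S → ℕ) (col : M.Num → M.Num → S) :
    Prop where
  hasColour_iff {i j : M.Num} (h : i < j) (a : S) : HasColour C i j (code a) ↔ col i j = a
  mul_eq {i j l : M.Num} (h : i < j) (h' : j < l) : col i j * col j l = col i l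

/-- The numbers `i` and `j` have the same colour with `l`. -/
def Merge (C : M.Sets) (code : S → ℕ) (i j l : M.Num) : Prop :=
  i < l ∧ j < l ∧ ∃ a, HasColour C i l (code a) ∧ HasColour C j l (code a)

theorem IsDelta0.merge [Finite S] {k n : ℕ} {X : Fin k → M.Sets}
    {f g h : (Fin n → M.Num) → M.Num} (hf : IsTermFun f) (hg : IsTermFun g) (hh : IsTermFun h)
    (code : S → ℕ) (p : Fin k) :
    IsDelta0 X fun x => Merge (X p) code (f x) (g x) (h x) :=
  .and (.lt hf hh) (.and (.lt hg hh)
    (.exists_fintype fun a => .and (.hasColour hf hh (code a) p) (.hasColour hg hh (code a) p)))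

/-- An external pigeonhole: `f` need not be definable in the model, because only a standard finite
number of bounds has to be dominated. -/
theorem exists_unbounded_fiber {ι : Type*} [Finite ι] (f : M.Num → ι) :
    ∃ p, ∀ n, ∃ x > n, f x = p := by
  by_contra! h
  choose b hb using h
  obtain ⟨n, hn⟩ := Finite.exists_le b
  exact hb (f (n + 1)) (n + 1) (num_lt_add_one_iff.2 (hn _)) rfl

/-! ### Eventual equality of colours and the clique. -/

namespace RepresentsAdditive

variable [Semigroup S] {C : M.Sets} {code : S → ℕ} {col : M.Num → M.Num → S}

theorem merge_iff (hC : RepresentsAdditive C code col) {i j l : M.Num} :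
    Merge C code i j l ↔ i < l ∧ j < l ∧ col i l = col j l := by
  refine and_congr_right fun hi => and_congr_right fun hj => ?_
  simp [hC.hasColour_iff hi, hC.hasColour_iff hj, eq_comm]

/-- This is where additivity enters: `C(i,l')` is the product of `C(i,l)` and `C(l,l')`, so it
depends on `i` only through `C(i,l)`. -/
theorem merge_mono (hC : RepresentsAdditive C code col) {i j l l' : M.Num}
    (h : Merge C code i j l) (hl : l ≤ l') : Merge C code i j l' := by
  obtain rfl | hl := hl.eq_or_lt
  · exact h
  · rw [hC.merge_iff] at h ⊢
    obtain ⟨hi, hj, h⟩ := h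
    exact ⟨hi.trans hl, hj.trans hl, by rw [← hC.mul_eq hi hl, ← hC.mul_eq hj hl, h]⟩

/-- Two numbers are equivalent if they eventually have the same colours. -/
def setoid (hC : RepresentsAdditive C code col) : Setoid M.Num where
  r i j := ∃ l, Merge C code i j l
  iseqv :=
    { refl i := ⟨i + 1, hC.merge_iff.2
        ⟨num_lt_add_one_iff.2 le_rfl, num_lt_add_one_iff.2 le_rfl, rfl⟩⟩
      symm := fun ⟨l, hi, hj, a, h, h'⟩ => ⟨l, hj, hi, a, h', h⟩
      trans := by
        rintro i j k ⟨l, h⟩ ⟨l', h'⟩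
        have h := hC.merge_iff.1 (hC.merge_mono h (le_max_left l l'))
        have h' := hC.merge_iff.1 (hC.merge_mono h' (le_max_right l l'))
        exact ⟨max l l', hC.merge_iff.2 ⟨h.1, h'.2.1, h.2.2.trans h'.2.2⟩⟩ }

/-- Inequivalent numbers have different colours with every larger number. Hence `|S| + 1`
representatives, all below one `l + 1`, would need more colours than `S` has. -/
theorem finite_quotient [Finite S] (hC : RepresentsAdditive C code col) :
    Finite (Quotient hC.setoid) := by
  cases nonempty_fintype S
  by_contra hinf
  rw [not_finite_iff_infinite] at hinf
  obtain ⟨T, hT⟩ := Infinite.exists_subset_card_eq (Quotient hC.setoid) (Fintype.card S + 1)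
  obtain ⟨l, hl⟩ := Finite.exists_le fun q : T => q.1.out
  have hlt (q : T) : q.1.out < l + 1 := num_lt_add_one_iff.2 (hl q)
  have hinj : Function.Injective fun q : T => col q.1.out (l + 1) := by
    intro p q hpq
    refine Subtype.ext ?_
    rw [← p.1.out_eq, ← q.1.out_eq]
    exact Quotient.sound ⟨l + 1, hC.merge_iff.2 ⟨hlt p, hlt q, hpq⟩⟩
  have := Fintype.card_le_of_injective _ hinj
  rw [Fintype.card_coe, hT] at this
  omega

/-- The number `m` of classes is standard, so all representatives together can serve as parameters
of a single formula. -/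
theorem exists_representatives [Finite S] (hC : RepresentsAdditive C code col) :
    ∃ (m : ℕ) (r : Fin m → M.Num) (cls : M.Num → Fin m),
      ∀ i p, (∃ l, Merge C code i (r p) l) ↔ cls i = p := by
  have := hC.finite_quotient
  obtain ⟨m, ⟨f⟩⟩ := Finite.exists_equiv_fin (Quotient hC.setoid)
  refine ⟨m, fun p => (f.symm p).out, fun i => f (Quotient.mk _ i), fun i p => ?_⟩
  rw [← f.eq_symm_apply, ← (f.symm p).out_eq, Quotient.eq]
  rfl

/-- There are `r` and `a` and an unbounded set of numbers `i > r` equivalent to `r` for which the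
colour of `(r, i)` is `a`. -/
theorem exists_unbounded_set [Finite S] (hC : RepresentsAdditive C code col) :
    ∃ (r : M.Num) (a : S) (A : M.Sets), (∀ n, ∃ i > n, M.mem i A) ∧
      ∀ i, M.mem i A → r < i ∧ col r i = a ∧ ∃ l, Merge C code i r l := by
  obtain ⟨m, r, cls, hr⟩ := hC.exists_representatives
  -- For `i` not above its representative the recorded colour is meaningless; taking `i` above `max
  -- n (r p)` below avoids these values.
  obtain ⟨⟨p, a⟩, hpa⟩ := exists_unbounded_fiber fun i => (cls i, col (r (cls i)) i)
  -- In the formulas `v 0` is `i` and `v q.succ` is the representative `r q`. `Q` expresses failure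
  -- of the bounded condition or equivalence to another representative.
  obtain ⟨A, hA⟩ := delta1_comprehension (X := ![C])
    (P := fun v : Fin (m + 1) → M.Num => ∃ l, (v p.succ < v 0 ∧
      HasColour C (v p.succ) (v 0) (code a)) ∧ Merge C code (v 0) (v p.succ) l)
    (Q := fun v => ∃ l, ¬ (v p.succ < v 0 ∧ HasColour C (v p.succ) (v 0) (code a)) ∨
      ∃ q, q ≠ p ∧ Merge C code (v 0) (v q.succ) l)
    (.ex (IsDelta0.and (.and (.lt (.var p.succ.succ) (.var 1))
        (.hasColour (.var p.succ.succ) (.var 1) (code a) 0))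
      (.merge (.var 1) (.var p.succ.succ) (.var 0) code 0)).sigma1)
    (.ex (IsDelta0.or (.not (.and (.lt (.var p.succ.succ) (.var 1))
        (.hasColour (.var p.succ.succ) (.var 1) (code a) 0)))
      (.exists_fintype fun q : Fin m => .and (.const _)
        (.merge (.var 1) (.var q.succ.succ) (.var 0) code 0))).sigma1)
    r (fun i => by
      change (∃ l, (r p < i ∧ HasColour C (r p) i (code a)) ∧ Merge C code i (r p) l) ↔
        ¬ ∃ l, ¬ (r p < i ∧ HasColour C (r p) i (code a)) ∨ ∃ q, q ≠ p ∧ Merge C code i (r q) l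
      constructor
      · rintro ⟨l, h, hl⟩ ⟨l', h' | ⟨q, hq, hl'⟩⟩
        · exact h' h
        · exact hq (((hr i q).1 ⟨l', hl'⟩).symm.trans ((hr i p).1 ⟨l, hl⟩))
      · intro h
        obtain ⟨l, hl⟩ := (hr i (cls i)).2 rfl
        have hp : cls i = p := by_contra fun hp => h ⟨l, Or.inr ⟨cls i, hp, hl⟩⟩
        exact ⟨l, by_contra fun h' => h ⟨l, Or.inl h'⟩, hp ▸ hl⟩)
  change ∀ i, M.mem i A ↔
    ∃ l, (r p < i ∧ HasColour C (r p) i (code a)) ∧ Merge C code i (r p) l at hA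
  refine ⟨r p, a, A, fun n => ?_, fun i hi => ?_⟩
  · obtain ⟨i, hi, hpi⟩ := hpa (max n (r p))
    obtain ⟨rfl, rfl⟩ := Prod.mk.inj hpi
    obtain ⟨hn, hri⟩ := max_lt_iff.1 hi
    obtain ⟨l, hl⟩ := (hr i (cls i)).2 rfl
    exact ⟨i, hn, (hA i).2 ⟨l, ⟨hri, (hC.hasColour_iff hri _).2 rfl⟩, hl⟩⟩
  · obtain ⟨l, ⟨hri, hcol⟩, hl⟩ := (hA i).1 hi
    exact ⟨hri, (hC.hasColour_iff hri a).1 hcol, l, hl⟩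

/-- Bounding: the elements of `A` below `n` merge with `r` before a common number. -/
theorem exists_common_merge [Finite S] (hC : RepresentsAdditive C code col) {A : M.Sets}
    {r : M.Num} (hA : ∀ i, M.mem i A → ∃ l, Merge C code i r l) (n : M.Num) :
    ∃ l, ∀ i < n, M.mem i A → Merge C code i r l := by
  refine sigma1_induction_add_one (X := ![A, C])
    (P := fun v => ∃ l, ∀ i < v 0, M.mem i A → Merge C code i (v 1) l)
    (.ex (IsDelta0.allLT (.var 1) (.imp (.mem (.var 0) 0)
      (.merge (.var 0) (.var 3) (.var 1) code 1))).sigma1) ![r]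
    ⟨0, fun x hx => absurd hx not_lt_zero⟩ ?_ n
  rintro z ⟨l, hl⟩
  change ∀ i < z, M.mem i A → Merge C code i r l at hl
  change ∃ l, ∀ i < z + 1, M.mem i A → Merge C code i r l
  by_cases hz : M.mem z A
  · obtain ⟨l', hl'⟩ := hA z hz
    refine ⟨max l l', fun i hi hiA => ?_⟩
    obtain rfl | hi := (num_lt_add_one_iff.1 hi).eq_or_lt
    · exact hC.merge_mono hl' (le_max_right _ _)
    · exact hC.merge_mono (hl i hi hiA) (le_max_left _ _)
  · refine ⟨l, fun i hi hiA => ?_⟩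
    obtain rfl | hi := (num_lt_add_one_iff.1 hi).eq_or_lt
    · exact absurd hiA hz
    · exact hl i hi hiA

theorem exists_clique [Finite S] (hC : RepresentsAdditive C code col) :
    ∃ (a : S) (I : M.Sets), (∀ n, ∃ i > n, M.mem i I) ∧
      ∀ i j, M.mem i I → M.mem j I → i < j → HasColour C i j (code a) := by
  obtain ⟨r, a, A, hunb, hA⟩ := hC.exists_unbounded_set
  obtain ⟨I, hI⟩ := exists_greedy A C (code a : M.Num)
  refine ⟨a, I, ?_, fun i j hi hj hij => ((hI j).1 hj).2 i hij hi⟩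
  by_contra! hbdd
  obtain ⟨n, hn⟩ := hbdd
  -- All elements of `I` are at most `n`, hence the bound `n + 1`.
  obtain ⟨l, hl⟩ := hC.exists_common_merge (fun i hi => (hA i hi).2.2) (n + 1)
  obtain ⟨x, hx, hxA⟩ := hunb (max n l)
  obtain ⟨hnx, hlx⟩ := max_lt_iff.1 hx
  refine hn x hnx ((hI x).2 ⟨hxA, fun y hyx hy => ?_⟩)
  have hyn : y < n + 1 := num_lt_add_one_iff.2 (not_lt.1 fun h => hn y h hy)
  have hm := hC.merge_iff.1 (hC.merge_mono (hl y hyn ((hI y).1 hy).1) hlx.le)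
  exact (hC.hasColour_iff hyx a).2 (hm.2.2.trans (hA x hxA).2.1)

end RepresentsAdditive

/-! ### The additive Ramsey theorem -/

variable [Mul S] {s : ℕ}

theorem holds_mulTable {k n : ℕ} (e : S ≃ Fin s) (X : Fin k → M.Sets) (x : Fin n → M.Num)
    (t₁ t₂ t₃ : Term n) :
    (Formula.mulTable e t₁ t₂ t₃ : Formula k n).Holds M X x ↔
      ∃ a b : S, t₁.eval M x = ((e a : ℕ) : M.Num) ∧ t₂.eval M x = ((e b : ℕ) : M.Num) ∧
        t₃.eval M x = ((e (a * b) : ℕ) : M.Num) := by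
  simp only [Formula.mulTable, Formula.holds_disj, List.mem_map, List.mem_product,
    List.mem_finRange, and_self, true_and, Prod.exists]
  constructor
  · rintro ⟨_, ⟨p, q, rfl⟩, h⟩
    simp only [Formula.Holds, eval_numeral] at h
    exact ⟨e.symm p, e.symm q, by simpa [and_assoc] using h⟩
  · rintro ⟨a, b, h⟩
    refine ⟨_, ⟨e a, e b, rfl⟩, ?_⟩
    simp only [Formula.Holds, eval_numeral]
    simpa [and_assoc] using h

/-- A set satisfying the formulas for additive colourings represents an additive colouring. -/
theorem exists_representsAdditive (e : S ≃ Fin s) (C : M.Sets)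
    (hcol : (Formula.isColouring s (0 : Fin 1)).Holds M (Fin.cons C Fin.elim0) Fin.elim0)
    (hadd : (Formula.isAdditive e (0 : Fin 1)).Holds M (Fin.cons C Fin.elim0) Fin.elim0) :
    ∃ col : M.Num → M.Num → S, RepresentsAdditive C (fun a => (e a : ℕ)) col := by
  have hex (i j : M.Num) (h : i < j) : ∃ a : S, ∀ b : S, HasColour C i j (e b) ↔ a = b := by
    have h2 := hcol.2 i j
    simp only [Formula.holds_imp, Formula.Holds, eval_numeral, Formula.colourEq, eval_pair] at h2
    obtain ⟨c, ⟨hc, hmem⟩, huniq⟩ := h2 h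
    obtain ⟨m, hm, rfl⟩ := eq_natCast_of_lt hc
    refine ⟨e.symm ⟨m, hm⟩, fun b => ⟨fun hb => ?_, ?_⟩⟩
    · have := huniq ((e b : ℕ) : M.Num) ⟨(lt_def _ _).2 (Nat.cast_lt.2 (e b).2), hb⟩
      rw [e.symm_apply_eq]
      exact Fin.ext (Nat.cast_injective this).symm
    · rintro rfl
      rw [e.apply_symm_apply]
      exact hmem
  -- The colour of the pair `(0, 1)` supplies an element of `S`, used as the default value of `col`
  -- where `i < j` fails.
  have hne : Nonempty S := ⟨(hex 0 (0 + 1) (num_lt_add_one_iff.2 le_rfl)).choose⟩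
  have hex' (i j : M.Num) : ∃ a : S, i < j → ∀ b : S, HasColour C i j (e b) ↔ a = b := by
    by_cases h : i < j
    · obtain ⟨a, ha⟩ := hex i j h
      exact ⟨a, fun _ => ha⟩
    · exact ⟨hne.some, fun h' => absurd h' h⟩
  choose col hcolour using hex'
  refine ⟨col, fun h => hcolour _ _ h, fun {i j l} h h' => ?_⟩
  -- The table determines its entries only as numerals; injectivity of the cast and of `e` brings
  -- the equation back to `S`.
  have h3 := hadd i j l (e (col i j) : ℕ) (e (col j l) : ℕ) (e (col i l) : ℕ)
  rw [Formula.holds_imp, holds_mulTable] at h3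
  obtain ⟨a, b, h1, h2, h3⟩ := h3 ⟨⟨h, h'⟩, ⟨(hcolour _ _ h _).2 rfl, (hcolour _ _ h' _).2 rfl⟩,
    (hcolour _ _ (h.trans h') _).2 rfl⟩
  have cast_inj {x y : S} (hxy : ((e x : ℕ) : M.Num) = ((e y : ℕ) : M.Num)) : x = y :=
    e.injective (Fin.ext (Nat.cast_injective hxy))
  rw [cast_inj h1, cast_inj h2, cast_inj h3]

end Colouring

end SOArith

theorem mainTheorem11 {S : Type w} [Semigroup S] [Finite S] (e : S ≃ Fin (Nat.card S)) :
    SOArith.Proves.{u, v} SOArith.RCA₀ (SOArith.Formula.additiveRamsey e) := by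
  intro M hM C
  have : M.IsRCA := ⟨hM⟩
  rw [SOArith.Formula.holds_imp]
  rintro ⟨hcol, hadd⟩
  obtain ⟨col, hC⟩ := SOArith.exists_representsAdditive e C hcol hadd
  obtain ⟨a, I, hunb, hI⟩ := hC.exists_clique
  refine ⟨((e a : ℕ) : M.Num), ?_, I, ?_, fun i j => ?_⟩
  · change M.lt _ _
    rw [SOArith.Term.eval_lift, SOArith.Model.eval_numeral]
    exact Nat.cast_lt (α := M.Num).2 (e a).2
  · exact fun n => (hunb n).imp fun _ h => h
  · rw [SOArith.Formula.holds_imp]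
    rintro ⟨⟨hi, hj⟩, hij⟩
    simp only [SOArith.Formula.colourEq, SOArith.Formula.Holds, SOArith.Model.eval_pair,
      SOArith.Term.eval_lift]
    exact hI i j hi hj hij
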